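/- Let $d\in\mathbb N$ and let $\mathcal W=(w_N)_{N\in\mathbb N}$ be an increasing weight system on $\mathbb R^d$, that is, a pointwise increasing sequence of positive continuous functions $w_N:\mathbb R^d\to(0,\infty)$. Suppose that $$\forall N\in\mathbb N\ \exists \widetilde N\ge N:\quad y\mapsto \sup_{x\in\mathbb R^d}\frac{w_N(x+y)}{w_{\widetilde N}(x)}\ \text{ belongs to } L^\infty_{\mathrm{loc}}(\mathbb R^d).$$ Let $L^1_{\mathcal W}(\mathbb R^d)=\varprojlim_N L^1_{w_N}(\mathbb R^d)$ be the space of (classes of) measurable functions $g:\mathbb R^d\to\mathbb C$ with $\|g\|_{L^1_{w_N}}:=\int_{\mathbb R^d}|g(x)|w_N(x)\,dx<\infty$ for all $N$, with the topology given by these norms. Let $$\mathcal O'_C(\mathcal D,L^1_{\mathcal W}):=\{f\in\mathcal D'(\mathbb R^d): f*\varphi\in L^1_{\mathcal W}(\mathbb R^d)\ \text{for all}\ \varphi\in\mathcal D(\mathbb R^d)\},\qquad (f*\varphi)(x)=\langle f,\varphi(x-\cdot)\rangle,$$ be endowed with the initial topology with respect to the mapping $$\mathcal O'_C(\mathcal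 D,L^1_{\mathcal W})\to L_b(\mathcal D(\mathbb R^d),L^1_{\mathcal W}(\mathbb R^d)),\qquad f\mapsto(\varphi\mapsto f*\varphi),$$ where the index $b$ stands for the topology of uniform convergence on bounded subsets of $\mathcal D(\mathbb R^d)$. Then the space $\mathcal O'_C(\mathcal D,L^1_{\mathcal W})$ is complete. -/

import Mathlib

open MeasureTheory TopologicalSpace
open scoped ENNReal Distributions

noncomputable section

namespace WeightedConvolutors

/-- The Euclidean space `ℝ^d`. -/
abbrev Rd (d : ℕ) : Type := EuclideanSpace ℝ (Fin d)

/-- The space `𝓓(ℝ^d)` of complex-valued test functions on `ℝ^d`, with its usual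
(LF)-space topology. -/
abbrev Test (d : ℕ) : Type := 𝓓((⊤ : Opens (Rd d)), ℂ)

/-- The space `𝓓'(ℝ^d)` of complex distributions: continuous `ℂ`-linear functionals on `𝓓(ℝ^d)`. -/
abbrev Distr (d : ℕ) : Type := Test d →L[ℂ] ℂ

/-- An increasing weight system: a pointwise increasing sequence of positive continuous functions
on `ℝ^d`. -/
structure IncreasingWeightSystem (d : ℕ) where
  w : ℕ → Rd d → ℝ
  continuous_w : ∀ N, Continuous (w N)
  pos : ∀ N x, 0 < w N x
  mono : Monotone w

variable {d : ℕ}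

namespace IncreasingWeightSystem

/-- `h_{N,M}(y) = sup_x w_N(x + y) / w_M(x)`, with values in `[0, ∞]`. -/
def h (W : IncreasingWeightSystem d) (N M : ℕ) (y : Rd d) : ℝ≥0∞ :=
  ⨆ x : Rd d, ENNReal.ofReal (W.w N (x + y) / W.w M x)

/-- For every `N` there is `M ≥ N` such that `h_{N,M}` belongs to `L^∞_loc(ℝ^d)`, that is,
`h_{N,M}` is essentially bounded on every compact set (as a supremum of continuous functions it is
automatically measurable). -/
def IsLocallyBounded (W : IncreasingWeightSystem d) : Prop :=
  ∀ N : ℕ, ∃ M : ℕ, N ≤ M ∧ ∀ K : Set (Rd d), IsCompact K →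
    essSup (W.h N M) (volume.restrict K) < ∞

/-- `g` is a (Lebesgue) measurable function with `∫ |g(x)| w_N(x) dx < ∞` for all `N`. -/
def MemL1 (W : IncreasingWeightSystem d) (g : Rd d → ℂ) : Prop :=
  AEStronglyMeasurable g volume ∧ ∀ N, Integrable (fun x => ‖g x‖ * W.w N x) volume

variable (W : IncreasingWeightSystem d)

theorem memL1_congr {f g : Rd d → ℂ} (hfg : f =ᵐ[volume] g) (hf : W.MemL1 f) : W.MemL1 g := by
  refine ⟨hf.1.congr hfg, fun N => (hf.2 N).congr ?_⟩
  filter_upwards [hfg] with x hx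
  rw [hx]

theorem memL1_zero : W.MemL1 (fun _ => 0) :=
  ⟨aestronglyMeasurable_const, fun N => by simp⟩

theorem memL1_add {f g : Rd d → ℂ} (hf : W.MemL1 f) (hg : W.MemL1 g) :
    W.MemL1 (fun x => f x + g x) := by
  refine ⟨hf.1.add hg.1, fun N => ((hf.2 N).add (hg.2 N)).mono' ?_ ?_⟩
  · exact (hf.1.add hg.1).norm.mul (W.continuous_w N).aestronglyMeasurable
  · refine Filter.Eventually.of_forall fun x => ?_
    have h0 := (W.pos N x).le
    rw [Real.norm_of_nonneg (by positivity)]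
    simp only [Pi.add_apply, ← add_mul]
    exact mul_le_mul_of_nonneg_right (norm_add_le _ _) h0

theorem memL1_smul {f : Rd d → ℂ} (c : ℂ) (hf : W.MemL1 f) :
    W.MemL1 (fun x => c * f x) := by
  refine ⟨hf.1.const_mul c, fun N => ?_⟩
  simpa [mul_assoc] using (hf.2 N).const_mul ‖c‖

end IncreasingWeightSystem

/-! ### The Fréchet space `L^1_W(ℝ^d)` -/

/-- The vector space underlying `L^1_W(ℝ^d)`, as a subspace of the space of classes of measurable
functions modulo equality almost everywhere. -/
def l1Submodule (W : IncreasingWeightSystem d) : Submodule ℂ (Rd d →ₘ[volume] ℂ) where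
  carrier := {f | W.MemL1 f}
  zero_mem' := W.memL1_congr AEEqFun.coeFn_zero.symm W.memL1_zero
  add_mem' := fun {f g} hf hg => W.memL1_congr (AEEqFun.coeFn_add f g).symm (W.memL1_add hf hg)
  smul_mem' := fun c f hf => W.memL1_congr (AEEqFun.coeFn_smul c f).symm (W.memL1_smul c hf)

/-- The space `L^1_W(ℝ^d)`. -/
def L1 (W : IncreasingWeightSystem d) : Type := l1Submodule W

namespace L1

variable (W : IncreasingWeightSystem d)

instance : AddCommGroup (L1 W) := inferInstanceAs (AddCommGroup (l1Submodule W))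

instance : Module ℂ (L1 W) := inferInstanceAs (Module ℂ (l1Submodule W))

variable {W}

/-- The underlying class of measurable functions. -/
def toAEEqFun (f : L1 W) : Rd d →ₘ[volume] ℂ := Subtype.val f

/-- The class in `L^1_W` of a function. -/
def mk (g : Rd d → ℂ) (hg : W.MemL1 g) : L1 W :=
  ⟨AEEqFun.mk g hg.1, W.memL1_congr (AEEqFun.coeFn_mk g hg.1).symm hg⟩

variable (W)

/-- The norm `‖f‖_{L^1_{w_N}} = ∫ |f(x)| w_N(x) dx`, as a seminorm on `L^1_W`. -/
def seminorm (N : ℕ) : Seminorm ℂ (L1 W) :=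
  Seminorm.of (fun f => ∫ x, ‖f.toAEEqFun x‖ * W.w N x)
    (fun f g => by
      have hf : W.MemL1 f.toAEEqFun := f.2
      have hg : W.MemL1 g.toAEEqFun := g.2
      have hfg : W.MemL1 (f + g).toAEEqFun := (f + g).2
      rw [← integral_add (hf.2 N) (hg.2 N)]
      refine integral_mono_ae (hfg.2 N) ((hf.2 N).add (hg.2 N)) ?_
      filter_upwards [AEEqFun.coeFn_add f.toAEEqFun g.toAEEqFun] with x hx
      have hx' : (f + g).toAEEqFun x = f.toAEEqFun x + g.toAEEqFun x := hx
      simp only [hx', ← add_mul]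
      exact mul_le_mul_of_nonneg_right (norm_add_le _ _) (W.pos N x).le)
    (fun c f => by
      rw [← integral_const_mul]
      refine integral_congr_ae ?_
      filter_upwards [AEEqFun.coeFn_smul c f.toAEEqFun] with x hx
      have hx' : (c • f).toAEEqFun x = c • f.toAEEqFun x := hx
      simp only [hx', norm_smul, mul_assoc])

/-- The projective limit structure on `L^1_W = proj lim_N L^1_{w_N}`: the coarsest uniform structure
finer than those given by the norms `‖·‖_{L^1_{w_N}}`. -/
instance : UniformSpace (L1 W) :=
  ⨅ N, (seminorm W N).toSeminormedAddCommGroup.toUniformSpace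

instance : IsUniformAddGroup (L1 W) :=
  isUniformAddGroup_iInf fun N =>
    letI := (seminorm W N).toSeminormedAddCommGroup
    inferInstance

/-- The topology of `L^1_W` is the locally convex topology given by the norms
`‖·‖_{L^1_{w_N}}`. -/
theorem withSeminorms : WithSeminorms (seminorm W) :=
  (SeminormFamily.withSeminorms_iff_uniformSpace_eq_iInf (p := seminorm W)).2 rfl

end L1

/-! ### Convolution of a distribution with a test function -/

/-- The test function `y ↦ φ(x - y)`. -/
def reflectTranslate (φ : Test d) (x : Rd d) : Test d where
  toFun y := φ (x - y)
  contDiff' := φ.contDiff.comp (contDiff_const.sub contDiff_id)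
  hasCompactSupport' := φ.hasCompactSupport.comp_homeomorph (Homeomorph.subLeft x)
  tsupport_subset' := fun _ _ => trivial

/-- The convolution `(f ∗ φ)(x) = ⟨f(y), φ(x - y)⟩` of `f ∈ 𝓓'(ℝ^d)` and `φ ∈ 𝓓(ℝ^d)`. -/
def conv (f : Distr d) (φ : Test d) (x : Rd d) : ℂ := f (reflectTranslate φ x)

/-! ### The convolutor space -/

/-- The vector space of all distributions `f` with `f ∗ φ ∈ L^1_W` for all `φ ∈ 𝓓(ℝ^d)`. -/
def convolutorSubmodule (W : IncreasingWeightSystem d) : Submodule ℂ (Distr d) where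
  carrier := {f | ∀ φ : Test d, W.MemL1 (conv f φ)}
  zero_mem' := fun _ => W.memL1_zero
  add_mem' := fun hf hg φ => W.memL1_add (hf φ) (hg φ)
  smul_mem' := fun c _ hf φ => W.memL1_smul c (hf φ)

/-- The convolutor space `𝓞'_C(𝓓, L^1_W)`. It is a type of its own, since it carries a topology
different from the one induced by `𝓓'(ℝ^d)`. -/
def Convolutor (W : IncreasingWeightSystem d) : Type := convolutorSubmodule W

namespace Convolutor

variable (W : IncreasingWeightSystem d)

instance : AddCommGroup (Convolutor W) := inferInstanceAs (AddCommGroup (convolutorSubmodule W))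

instance : Module ℂ (Convolutor W) := inferInstanceAs (Module ℂ (convolutorSubmodule W))

variable {W}

/-- The underlying distribution. -/
def toDistr (f : Convolutor W) : Distr d := Subtype.val f

/-- The map `φ ↦ f ∗ φ` from `𝓓(ℝ^d)` to `L^1_W(ℝ^d)`. -/
def convL1 (f : Convolutor W) (φ : Test d) : L1 W := L1.mk (conv f.toDistr φ) (f.2 φ)

variable (W)

/-- The map `f ↦ (φ ↦ f ∗ φ)`, the target being equipped with the structure of uniform convergence
on the bounded subsets of `𝓓(ℝ^d)`. The space `L_b(𝓓(ℝ^d), L^1_W(ℝ^d))` of continuous linear maps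
carries by definition the structure induced by this target. -/
def toUniformOnBounded :
    Convolutor W →+ UniformOnFun (Test d) (L1 W) {B | Bornology.IsVonNBounded ℂ B} where
  toFun f := UniformOnFun.ofFun {B | Bornology.IsVonNBounded ℂ B} f.convL1
  map_zero' := rfl
  map_add' _ _ := rfl

/-- The initial structure with respect to `f ↦ (φ ↦ f ∗ φ)` into `L_b(𝓓(ℝ^d), L^1_W(ℝ^d))`. -/
instance : UniformSpace (Convolutor W) :=
  UniformSpace.comap (toUniformOnBounded W) inferInstance

instance : IsUniformAddGroup (Convolutor W) :=
  IsUniformAddGroup.comap (toUniformOnBounded W)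

end Convolutor

end WeightedConvolutors

end

/-!
The functional `f ↦ f(φ)` is controlled by the topology of the convolutor space, and this makes a
Cauchy filter of convolutors converge to a distribution first; the limit is then recognised as a
convolutor and as the limit in the finer topology.

Control of point values: `f ∗ φ` is smooth with `∂_e (f ∗ φ) = f ∗ ∂_e φ` (`hasDerivAt_conv`), so
the Sobolev embedding `W^{d,1} ⊆ L^∞` on a unit cube, in the form obtained by applying the
one-dimensional inequality `|v(a)| ≤ ∫ |v| + ∫ |v'|` to one coordinate after the other
(`exists_enorm_conv_le_lmarginal`), bounds `f(φ) = (f ∗ φˇ)(0)`, where `φˇ(y) = φ(-y)`, by finitely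
many norms `‖f ∗ P φˇ‖_{L^1_{w_0}}` with differential operators `P` (`exists_norm_conv_zero_le`);
the weight `w_0` is bounded below on the cube. The operators `P` preserve bounded sets of test
functions.

The limit: a Cauchy filter is therefore Cauchy uniformly on the sets `boundedFamily K C` of test
functions with common support `K` and common bounds `C k` on the derivatives. The pointwise limit is
a linear functional, and the convergence is uniform on these sets; as `𝓓_K` is first countable and
null sequences in `𝓓_K` lie in such sets, the limit `ℓ` is a distribution
(`Convolutor.exists_distr_of_cauchy`).

Convergence: for fixed `φ` the translates `φ(x - ·)` with `‖x‖ ≤ n` lie in one set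
`boundedFamily K C`, so some sequence `g_n` taken from small sets of the filter satisfies
`g_n ∗ φ → ℓ ∗ φ` locally uniformly, and Fatou's lemma transfers the Cauchy estimates
`‖(f - g_n) ∗ φ‖_{L^1_{w_N}} ≤ ε` to `f - ℓ` (`Convolutor.lintegral_conv_sub_mul_le`). This shows
both that `ℓ ∗ φ` belongs to `L^1_W` and that the filter converges to `ℓ` uniformly on bounded sets.
-/

noncomputable section

namespace WeightedConvolutors

open Filter Topology Set
open scoped ContDiff

universe u

variable {d : ℕ}

/-! ### Iterated derivatives under translation and reflection -/

section IteratedDerivatives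

variable {E F : Type*} [NormedAddCommGroup E] [NormedSpace ℝ E]
  [NormedAddCommGroup F] [NormedSpace ℝ F]

theorem norm_iteratedFDeriv_comp_const_sub (g : E → F) (k : ℕ) (x y : E) :
    ‖iteratedFDeriv ℝ k (fun z => g (x - z)) y‖ = ‖iteratedFDeriv ℝ k g (x - y)‖ := by
  have h : (fun z => g (x - z)) = (fun z => g (x + z)) ∘ LinearIsometryEquiv.neg ℝ := by
    ext z; simp [sub_eq_add_neg]
  rw [h, LinearIsometryEquiv.norm_iteratedFDeriv_comp_right, iteratedFDeriv_comp_add_left]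
  simp [sub_eq_add_neg]

/-- Directional derivatives commute with iterated derivatives, by the symmetry of second
derivatives. -/
theorem fderiv_iteratedFDeriv_apply {E : Type u} {F : Type u} [NormedAddCommGroup E]
    [NormedSpace ℝ E] [NormedAddCommGroup F] [NormedSpace ℝ F] {f : E → F}
    (hf : ContDiff ℝ ∞ f) (e : E) (k : ℕ) (z : E) :
    fderiv ℝ (iteratedFDeriv ℝ k f) z e = iteratedFDeriv ℝ k (fun y => fderiv ℝ f y e) z := by
  induction k generalizing F with
  | zero =>
    ext m
    have h : iteratedFDeriv ℝ 0 f =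
        (continuousMultilinearCurryFin0 ℝ E F).symm ∘ f := iteratedFDeriv_zero_eq_comp
    rw [h, LinearIsometryEquiv.comp_fderiv]
    simp
  | succ k ih =>
    have hf' : ContDiff ℝ ∞ (fderiv ℝ f) := hf.fderiv_right (by simp)
    have hd : Differentiable ℝ (fderiv ℝ f) := hf'.differentiable (by simp)
    ext m
    have hsymm : fderiv ℝ (fun y => fderiv ℝ f y e) = fun y => fderiv ℝ (fderiv ℝ f) y e := by
      ext y v
      rw [fderiv_clm_apply (hd y) (differentiableAt_const e)]
      simpa using (hf.contDiffAt.isSymmSndFDerivAt (by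
        simpa using (show ((2 : ℕ∞) : WithTop ℕ∞) ≤ ((⊤ : ℕ∞) : WithTop ℕ∞) by
          exact_mod_cast le_top)))
        v e
    have hdk : DifferentiableAt ℝ (iteratedFDeriv ℝ (k + 1) f) z :=
      (hf.differentiable_iteratedFDeriv (by exact_mod_cast ENat.natCast_lt_top _)) z
    have hdk' : DifferentiableAt ℝ (iteratedFDeriv ℝ k (fderiv ℝ f)) z :=
      (hf'.differentiable_iteratedFDeriv (by exact_mod_cast ENat.natCast_lt_top _)) z
    rw [← fderiv_continuousMultilinear_apply_const_apply hdk, iteratedFDeriv_succ_apply_right,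
      hsymm, ← ih hf', ← fderiv_continuousMultilinear_apply_const_apply hdk']
    simp_rw [iteratedFDeriv_succ_apply_right]
    rw [fderiv_clm_apply (hdk'.continuousMultilinear_apply_const _) (differentiableAt_const _)]
    simp

/-- The first order Taylor estimate at `0` for a function whose derivative satisfies a
Lipschitz estimate at `0`. -/
theorem norm_sub_sub_smul_le_of_lipschitz {g g' : ℝ → F} {L : ℝ} (hL0 : 0 ≤ L)
    (hg : ∀ t, HasDerivAt g (g' t) t) (hL : ∀ t, ‖g' t - g' 0‖ ≤ L * |t|) (t : ℝ) :
    ‖g t - g 0 - t • g' 0‖ ≤ L * |t| * |t| := by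
  have h := Convex.norm_image_sub_le_of_norm_hasDerivWithin_le (f := fun s => g s - s • g' 0)
    (f' := fun s => g' s - g' 0) (s := Icc (-|t|) |t|) (C := L * |t|) (x := 0) (y := t)
    (fun s _ => ((hg s).sub (by simpa using (hasDerivAt_id s).smul_const (g' 0))).hasDerivWithinAt)
    (fun s hs => (hL s).trans (mul_le_mul_of_nonneg_left (abs_le.2 hs) hL0))
    (convex_Icc _ _) ⟨by simp, by simp⟩ (abs_le.1 le_rfl)
  simpa [sub_right_comm] using h

end IteratedDerivatives

/-! ### Bounded sets and null sequences of test functions -/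

/-- The set of test functions supported in `K` whose derivatives of order `k` are bounded by `C k`,
for all `k`. -/
def boundedFamily (K : Compacts (Rd d)) (C : ℕ → ℝ) : Set (Test d) :=
  {φ | Function.support φ ⊆ K ∧ ∀ k y, ‖iteratedFDeriv ℝ k φ y‖ ≤ C k}

theorem isVonNBounded_boundedFamily (K : Compacts (Rd d)) (C : ℕ → ℝ) :
    Bornology.IsVonNBounded ℂ (boundedFamily K C) := by
  have hsub : (K : Set (Rd d)) ⊆ ((⊤ : Opens (Rd d)) : Set (Rd d)) := fun _ _ => trivial
  have hb : Bornology.IsVonNBounded ℂ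
      {ψ : 𝓓_{K}(Rd d, ℂ) | ∀ k y, ‖iteratedFDeriv ℝ k ψ y‖ ≤ C k} := by
    rw [(ContDiffMapSupportedIn.withSeminorms ℂ (Rd d) ℂ ⊤ K).isVonNBounded_iff_seminorm_bounded]
    intro k
    refine ⟨max (C k) 0 + 1, by positivity, fun ψ hψ => lt_of_le_of_lt ?_ (lt_add_one _)⟩
    rw [ContDiffMapSupportedIn.seminorm_top_le_iff ℂ (le_max_right _ _)]
    exact fun y _ => (hψ k y).trans (le_max_left _ _)
  refine (hb.image (TestFunction.ofSupportedInCLM ℂ (Ω := ⊤) hsub)).subset ?_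
  rintro φ ⟨h1, h2⟩
  exact ⟨.of_support_subset φ.contDiff h1, h2, rfl⟩

theorem exists_mem_boundedFamily (φ : Test d) : ∃ K C, φ ∈ boundedFamily K C := by
  have h : ∀ k : ℕ, ∃ C, ∀ y, ‖iteratedFDeriv ℝ k φ y‖ ≤ C := fun k =>
    Continuous.bounded_above_of_compact_support
      (φ.contDiff.continuous_iteratedFDeriv (by exact_mod_cast le_top))
      (φ.hasCompactSupport.iteratedFDeriv k)
  choose C hC using h
  exact ⟨⟨tsupport φ, φ.hasCompactSupport⟩, C, subset_tsupport φ, hC⟩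

/-- Uniform convergence to `0` of all derivatives, with supports in a fixed compact set, implies
convergence to `0` in `𝓓(ℝ^d)`. -/
theorem tendsto_zero_of_iteratedFDeriv {ι : Type*} {l : Filter ι} {g : ι → Test d}
    (K : Compacts (Rd d)) (hK : ∀ᶠ i in l, Function.support (g i) ⊆ K)
    (hg : ∀ k : ℕ, ∀ ε > 0, ∀ᶠ i in l, ∀ y, ‖iteratedFDeriv ℝ k (g i) y‖ ≤ ε) :
    Tendsto g l (𝓝 0) := by
  classical
  have hsub : (K : Set (Rd d)) ⊆ ((⊤ : Opens (Rd d)) : Set (Rd d)) := fun _ _ => trivial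
  -- the family lies in `𝓓_K` only eventually; the other members are replaced by `0`
  let G : ι → 𝓓_{K}(Rd d, ℂ) := fun i =>
    if h : Function.support (g i) ⊆ K then .of_support_subset (g i).contDiff h else 0
  have hGg : ∀ i, Function.support (g i) ⊆ K → (G i : Rd d → ℂ) = g i := fun i hi => by
    simp only [G, dif_pos hi]; rfl
  have hG : Tendsto G l (𝓝 0) := by
    rw [(ContDiffMapSupportedIn.withSeminorms ℂ (Rd d) ℂ ⊤ K).tendsto_nhds]
    intro k ε hε
    filter_upwards [hK, hg k (ε / 2) (by positivity)] with i hi hi'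
    refine lt_of_le_of_lt ?_ (half_lt_self hε)
    rw [sub_zero, ContDiffMapSupportedIn.seminorm_top_le_iff ℂ (by positivity), hGg i hi]
    exact fun y _ => hi' y
  have h := ((TestFunction.ofSupportedInCLM ℂ (Ω := ⊤) (n := ⊤) (F := ℂ) hsub).continuous.tendsto
    0).comp hG
  rw [map_zero] at h
  refine h.congr' ?_
  filter_upwards [hK] with i hi
  ext y
  exact congrFun (hGg i hi) y

/-! ### Translates of a test function -/

theorem reflectTranslate_apply (φ : Test d) (x y : Rd d) : reflectTranslate φ x y = φ (x - y) := rfl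

theorem reflectTranslate_reflectTranslate (φ : Test d) (x : Rd d) :
    reflectTranslate (reflectTranslate φ x) x = φ := by
  ext y; simp [reflectTranslate_apply]

/-- Translates by vectors of norm at most `R` satisfy the same bounds `C`, with a larger common
support `K'` that depends on `K` and `R` only. -/
theorem exists_reflectTranslate_mem_boundedFamily (K : Compacts (Rd d)) (R : ℝ) :
    ∃ K' : Compacts (Rd d), ∀ C, ∀ φ ∈ boundedFamily K C, ∀ x, ‖x‖ ≤ R →
      reflectTranslate φ x ∈ boundedFamily K' C := by
  refine ⟨⟨(fun p : Rd d × Rd d => p.1 - p.2) '' (Metric.closedBall 0 R ×ˢ K),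
    ((isCompact_closedBall 0 R).prod K.isCompact).image (by fun_prop)⟩, ?_⟩
  rintro C φ ⟨h1, h2⟩ x hx
  refine ⟨fun y hy => ?_, fun k y => ?_⟩
  · exact ⟨(x, x - y), ⟨by simpa using hx, h1 hy⟩, by simp⟩
  · exact (norm_iteratedFDeriv_comp_const_sub φ k x y).trans_le (h2 k _)

/-- The derivatives of a test function are Lipschitz continuous. -/
theorem exists_norm_iteratedFDeriv_sub_le (φ : Test d) (k : ℕ) :
    ∃ L : ℝ, 0 ≤ L ∧ ∀ z z', ‖iteratedFDeriv ℝ k φ z - iteratedFDeriv ℝ k φ z'‖ ≤ L * ‖z - z'‖ := by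
  obtain ⟨K, C, -, hC⟩ := exists_mem_boundedFamily φ
  refine ⟨C (k + 1), (norm_nonneg _).trans (hC (k + 1) 0), fun z z' => ?_⟩
  refine Convex.norm_image_sub_le_of_norm_fderiv_le (𝕜 := ℝ) (s := univ) (fun w _ => ?_)
    (fun w _ => ?_) convex_univ trivial trivial
  · exact φ.contDiff.differentiable_iteratedFDeriv (by exact_mod_cast ENat.natCast_lt_top _) w
  · rw [norm_fderiv_iteratedFDeriv]; exact hC _ _

theorem exists_support_reflectTranslate_subset (φ : Test d) (R : ℝ) :
    ∃ K : Compacts (Rd d), ∀ x, ‖x‖ ≤ R → Function.support (reflectTranslate φ x) ⊆ K := by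
  obtain ⟨K, C, hφ⟩ := exists_mem_boundedFamily φ
  obtain ⟨K', hK'⟩ := exists_reflectTranslate_mem_boundedFamily K R
  exact ⟨K', fun x hx => (hK' C φ hφ x hx).1⟩

theorem continuous_conv (f : Distr d) (φ : Test d) : Continuous (conv f φ) := by
  rw [continuous_iff_continuousAt]
  intro x
  have key : Tendsto (fun x' => reflectTranslate φ x' - reflectTranslate φ x) (𝓝 x) (𝓝 0) := by
    obtain ⟨K, hK⟩ := exists_support_reflectTranslate_subset φ (‖x‖ + 1)
    refine tendsto_zero_of_iteratedFDeriv K ?_ fun k ε hε => ?_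
    · filter_upwards [Metric.ball_mem_nhds x one_pos] with x' hx'
      refine (Function.support_sub _ _).trans (union_subset (hK x' ?_) (hK x (by simp)))
      have := norm_sub_norm_le x' x
      rw [mem_ball_iff_norm] at hx'
      linarith
    · obtain ⟨L, hL0, hL⟩ := exists_norm_iteratedFDeriv_sub_le φ k
      have hlim : Tendsto (fun x' => L * ‖x' - x‖) (𝓝 x) (𝓝 0) := by
        have : Continuous fun x' => L * ‖x' - x‖ := by fun_prop
        simpa using this.tendsto x
      filter_upwards [hlim.eventually_le_const hε] with x' hx' y
      have hfun : ((reflectTranslate φ x' - reflectTranslate φ x : Test d) : Rd d → ℂ) =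
          fun y => (fun w => φ (w + (x' - x)) - φ w) (x - y) := by
        ext y
        change φ (x' - y) - φ (x - y) = φ (x - y + (x' - x)) - φ (x - y)
        congr 2; abel
      have hs : ContDiff ℝ ∞ φ := φ.contDiff
      have hk : ContDiff ℝ k φ := hs.of_le (by exact_mod_cast le_top)
      rw [hfun]
      refine (norm_iteratedFDeriv_comp_const_sub
        (fun w => φ (w + (x' - x)) - φ w) k x y).trans_le ?_
      rw [fun_iteratedFDeriv_sub_apply (by fun_prop) (by fun_prop), iteratedFDeriv_comp_add_right]
      refine (hL _ _).trans (le_of_eq_of_le ?_ hx')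
      simp
  have h := (f.continuous.tendsto 0).comp key
  rw [map_zero] at h
  rw [ContinuousAt, ← tendsto_sub_nhds_zero_iff]
  exact h.congr fun x' => by simp [conv]

/-- The directional derivative `∂_e`, as a continuous linear operator on `𝓓(ℝ^d)`. -/
abbrev dirDeriv (e : Rd d) : Test d →L[ℂ] Test d := TestFunction.lineDerivCLM ℂ e

theorem dirDeriv_apply (e : Rd d) (φ : Test d) (z : Rd d) :
    dirDeriv e φ z = fderiv ℝ φ z e := by
  rw [dirDeriv, TestFunction.lineDerivCLM_eq_fderivCLM,
    TestFunction.fderivCLM_apply_of_le _ (by simp)]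

/-- The difference quotients of a test function converge to its directional derivative, with all
derivatives and uniformly: the error is at most a multiple of the increment. -/
theorem exists_norm_iteratedFDeriv_slope_sub_le (φ : Test d) (e : Rd d) (k : ℕ) :
    ∃ L : ℝ, ∀ t : ℝ, t ≠ 0 → ∀ z, ‖iteratedFDeriv ℝ k
      (fun w => t⁻¹ • (φ (w + t • e) - φ w) - dirDeriv e φ w) z‖ ≤ L * |t| := by
  obtain ⟨L, hL0, hL⟩ := exists_norm_iteratedFDeriv_sub_le (dirDeriv e φ) k
  refine ⟨L * ‖e‖, fun t ht z => ?_⟩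
  have hs : ContDiff ℝ ∞ φ := φ.contDiff
  have hs' : ContDiff ℝ ∞ (dirDeriv e φ) := (dirDeriv e φ).contDiff
  have hk : ContDiff ℝ k φ := hs.of_le (by exact_mod_cast le_top)
  have hk' : ContDiff ℝ k (dirDeriv e φ) := hs'.of_le (by exact_mod_cast le_top)
  have hderiv : ∀ s : ℝ, HasDerivAt (fun s : ℝ => iteratedFDeriv ℝ k φ (z + s • e))
      (iteratedFDeriv ℝ k (dirDeriv e φ) (z + s • e)) s := fun s => by
    have h1 : DifferentiableAt ℝ (iteratedFDeriv ℝ k φ) (z + s • e) :=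
      hs.differentiable_iteratedFDeriv (by exact_mod_cast ENat.natCast_lt_top _) _
    have h2 : HasDerivAt (fun s : ℝ => z + s • e) e s := by
      simpa using ((hasDerivAt_id s).smul_const e).const_add z
    have h3 : (dirDeriv e φ : Rd d → ℂ) = fun y => fderiv ℝ φ y e :=
      funext fun y => dirDeriv_apply e φ y
    -- differentiation in `s` and in the space variable commute
    rw [h3, ← fderiv_iteratedFDeriv_apply hs]
    exact h1.hasFDerivAt.comp_hasDerivAt s h2
  have h := norm_sub_sub_smul_le_of_lipschitz (L := L * ‖e‖) (by positivity) hderiv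
    (fun s => (hL _ _).trans_eq (by simp [norm_smul]; ring)) t
  simp only [zero_smul, add_zero] at h
  rw [fun_iteratedFDeriv_sub_apply (by fun_prop) (by fun_prop),
    iteratedFDeriv_const_smul_apply' (by fun_prop),
    fun_iteratedFDeriv_sub_apply (by fun_prop) (by fun_prop), iteratedFDeriv_comp_add_right]
  have ht' : 0 < |t| := abs_pos.2 ht
  have heq : ∀ a b : (Rd d) [×k]→L[ℝ] ℂ, t⁻¹ • a - b = t⁻¹ • (a - t • b) := fun a b => by
    rw [smul_sub, smul_smul, inv_mul_cancel₀ ht, one_smul]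
  rw [heq, norm_smul, norm_inv, Real.norm_eq_abs, inv_mul_le_iff₀ ht']
  linarith

/-- Convolutions with test functions are differentiable, and `∂_e (f ∗ φ) = f ∗ ∂_e φ`. -/
theorem hasDerivAt_conv (f : Distr d) (φ : Test d) (x e : Rd d) (t₀ : ℝ) :
    HasDerivAt (fun t : ℝ => conv f φ (x + t • e)) (conv f (dirDeriv e φ) (x + t₀ • e)) t₀ := by
  rw [hasDerivAt_iff_tendsto_slope_zero]
  set x₀ := x + t₀ • e with hx₀
  let g : ℝ → Test d := fun t =>
    t⁻¹ • (reflectTranslate φ (x + (t₀ + t) • e) - reflectTranslate φ x₀) -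
      reflectTranslate (dirDeriv e φ) x₀
  have key : Tendsto g (𝓝[≠] 0) (𝓝 0) := by
    obtain ⟨K₁, hK₁⟩ := exists_support_reflectTranslate_subset φ (‖x₀‖ + ‖e‖)
    obtain ⟨K₂, hK₂⟩ := exists_support_reflectTranslate_subset (dirDeriv e φ) ‖x₀‖
    refine tendsto_zero_of_iteratedFDeriv (K₁ ⊔ K₂) ?_ fun k ε hε => ?_
    · filter_upwards [mem_nhdsWithin_of_mem_nhds (Metric.ball_mem_nhds (0 : ℝ) one_pos)] with t ht
      refine (Function.support_sub _ _).trans (union_subset_union ?_ (hK₂ _ le_rfl))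
      refine (Function.support_const_smul_subset _ _).trans ?_
      refine (Function.support_sub _ _).trans (union_subset (hK₁ _ ?_) (hK₁ _ (by simp)))
      have h1 : x + (t₀ + t) • e = x₀ + t • e := by rw [hx₀, add_smul, add_assoc]
      rw [h1]
      refine (norm_add_le _ _).trans (add_le_add le_rfl ?_)
      rw [norm_smul]
      exact mul_le_of_le_one_left (norm_nonneg _) (by simpa using ht : |t| < 1).le
    · obtain ⟨L, hL⟩ := exists_norm_iteratedFDeriv_slope_sub_le φ e k
      have hlim : Tendsto (fun t : ℝ => L * |t|) (𝓝[≠] 0) (𝓝 0) := by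
        have : Continuous fun t : ℝ => L * |t| := by fun_prop
        simpa using (this.tendsto 0).mono_left nhdsWithin_le_nhds
      filter_upwards [hlim.eventually_le_const hε, self_mem_nhdsWithin] with t ht ht0 y
      have hfun : (g t : Rd d → ℂ) = fun y =>
          (fun w => t⁻¹ • (φ (w + t • e) - φ w) - dirDeriv e φ w) (x₀ - y) := by
        ext y
        change t⁻¹ • (φ (x + (t₀ + t) • e - y) - φ (x₀ - y)) - dirDeriv e φ (x₀ - y) = _
        have h1 : x + (t₀ + t) • e - y = x₀ - y + t • e := by rw [hx₀, add_smul]; abel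
        rw [h1]
      rw [hfun]
      exact ((norm_iteratedFDeriv_comp_const_sub
        (fun w => t⁻¹ • (φ (w + t • e) - φ w) - dirDeriv e φ w) k x₀ y).trans_le
        (hL t ht0 _)).trans ht
  have h := (f.continuous.tendsto 0).comp key
  rw [map_zero] at h
  rw [← tendsto_sub_nhds_zero_iff]
  refine h.congr fun t => ?_
  have hsmul : ∀ ψ : Test d, f (t⁻¹ • ψ) = t⁻¹ • f ψ := f.toLinearMap.map_smul_of_tower t⁻¹
  simp only [Function.comp_apply, g, map_sub, hsmul]
  rfl

/-! ### A Sobolev inequality for convolutions -/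

/-- The one-dimensional Sobolev inequality on the unit interval. -/
theorem enorm_le_lintegral_Icc {v v' : ℝ → ℂ} (hv : ∀ t, HasDerivAt v (v' t) t)
    (hv' : Continuous v') {a : ℝ} (ha : a ∈ Icc (0 : ℝ) 1) :
    ‖v a‖ₑ ≤ ∫⁻ t in Icc (0 : ℝ) 1, (‖v t‖ₑ + ‖v' t‖ₑ) := by
  have hvc : Continuous v := continuous_iff_continuousAt.2 fun t => (hv t).continuousAt
  have hone : volume (Icc (0 : ℝ) 1) = 1 := by simp
  set I := ∫⁻ t in Icc (0 : ℝ) 1, ‖v' t‖ₑ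
  have h1 : ∀ t ∈ Icc (0 : ℝ) 1, ‖v a‖ₑ ≤ ‖v t‖ₑ + I := fun t ht => by
    have h2 : v a - v t = ∫ s in t..a, v' s :=
      (intervalIntegral.integral_eq_sub_of_hasDerivAt (fun s _ => hv s)
        (hv'.intervalIntegrable _ _)).symm
    have h3 : ‖v a - v t‖ₑ ≤ I := by
      rw [h2, ← ofReal_norm, intervalIntegral.norm_intervalIntegral_eq,
        ofReal_norm]
      refine (enorm_integral_le_lintegral_enorm _).trans (lintegral_mono_set ?_)
      exact uIoc_subset_uIcc.trans (ordConnected_Icc.uIcc_subset ht ha)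
    calc ‖v a‖ₑ = ‖v t + (v a - v t)‖ₑ := by rw [add_sub_cancel]
      _ ≤ _ := (enorm_add_le _ _).trans (add_le_add le_rfl h3)
  calc ‖v a‖ₑ = ∫⁻ _ in Icc (0 : ℝ) 1, ‖v a‖ₑ := by simp
    _ ≤ ∫⁻ t in Icc (0 : ℝ) 1, (‖v t‖ₑ + I) := setLIntegral_mono (by fun_prop) h1
    _ = _ := by
      rw [lintegral_add_left (by fun_prop), lintegral_add_left (by fun_prop)]
      simp [I]

/-- The point of `ℝ^d` with the given coordinates. -/
abbrev ofCoords (x : Fin d → ℝ) : Rd d := WithLp.toLp 2 x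

theorem hasDerivAt_conv_update (f : Distr d) (φ : Test d) (x : Fin d → ℝ) (i : Fin d) (t : ℝ) :
    HasDerivAt (fun t => conv f φ (ofCoords (Function.update x i t)))
      (conv f (dirDeriv (EuclideanSpace.single i 1) φ) (ofCoords (Function.update x i t))) t := by
  have h : ∀ t : ℝ, ofCoords (Function.update x i t) =
      ofCoords (Function.update x i 0) + t • EuclideanSpace.single i (1 : ℝ) := fun t => by
    ext j
    by_cases hj : j = i
    · subst hj; simp [ofCoords]
    · simp [ofCoords, hj]
  have hfun : (fun t => conv f φ (ofCoords (Function.update x i t))) = fun t =>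
      conv f φ (ofCoords (Function.update x i 0) + t • EuclideanSpace.single i (1 : ℝ)) :=
    funext fun t => by rw [h t]
  rw [hfun, h t]
  exact hasDerivAt_conv f φ _ _ t

theorem measurable_enorm_conv (f : Distr d) (φ : Test d) :
    Measurable fun y : Fin d → ℝ => ‖conv f φ (ofCoords y)‖ₑ := by
  have := (continuous_conv f φ).comp (PiLp.continuous_toLp 2 (fun _ : Fin d => ℝ))
  exact this.enorm.measurable

/-- The one-dimensional inequality, applied successively to the coordinates in `s`. -/
theorem exists_enorm_conv_le_lmarginal (s : Finset (Fin d)) :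
    ∃ (ι : Type) (_ : Fintype ι) (P : ι → (Test d →L[ℂ] Test d)), ∀ (f : Distr d) (φ : Test d)
      (x : Fin d → ℝ), (∀ i, x i ∈ Icc (0 : ℝ) 1) → ‖conv f φ (ofCoords x)‖ₑ ≤
        ∑ j, lmarginal (fun _ => volume.restrict (Icc (0 : ℝ) 1)) s
          (fun y => ‖conv f (P j φ) (ofCoords y)‖ₑ) x := by
  induction s using Finset.induction_on with
  | empty =>
    exact ⟨Unit, inferInstance, fun _ => ContinuousLinearMap.id ℂ (Test d), fun f φ x _ => by simp⟩
  | insert i s hi ih =>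
    obtain ⟨ι, _, P, hP⟩ := ih
    set D : Test d →L[ℂ] Test d := dirDeriv (EuclideanSpace.single i 1)
    refine ⟨ι ⊕ ι, inferInstance, Sum.elim P fun j => (P j).comp D, fun f φ x hx => ?_⟩
    have hmeas : ∀ ψ : Test d, Measurable fun t =>
        lmarginal (fun _ => volume.restrict (Icc (0 : ℝ) 1)) s
          (fun y => ‖conv f ψ (ofCoords y)‖ₑ) (Function.update x i t) := fun ψ =>
      ((measurable_enorm_conv f ψ).lmarginal _).comp (measurable_update x)
    have hcont : Continuous fun t => conv f (D φ) (ofCoords (Function.update x i t)) :=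
      continuous_iff_continuousAt.2 fun t => (hasDerivAt_conv_update f (D φ) x i t).continuousAt
    have h := enorm_le_lintegral_Icc (hasDerivAt_conv_update f φ x i) hcont (hx i)
    rw [Function.update_eq_self] at h
    refine h.trans ?_
    have hx' : ∀ t ∈ Icc (0 : ℝ) 1, ∀ j, Function.update x i t j ∈ Icc (0 : ℝ) 1 := fun t ht j => by
      by_cases hj : j = i
      · subst hj; simpa using ht
      · simpa [hj] using hx j
    refine (setLIntegral_mono ?_ fun t ht =>
      add_le_add (hP f φ _ (hx' t ht)) (hP f (D φ) _ (hx' t ht))).trans_eq ?_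
    · exact (Finset.measurable_fun_sum _ fun j _ => hmeas _).add
        (Finset.measurable_fun_sum _ fun j _ => hmeas _)
    rw [lintegral_add_left (Finset.measurable_fun_sum _ fun j _ => hmeas _),
      lintegral_finsetSum _ fun j _ => hmeas _, lintegral_finsetSum _ fun j _ => hmeas _,
      Fintype.sum_sum_type]
    simp_rw [lmarginal_insert _ (measurable_enorm_conv f _) hi]
    rfl

theorem L1.seminorm_mk (W : IncreasingWeightSystem d) (N : ℕ) (g : Rd d → ℂ) (hg : W.MemL1 g) :
    L1.seminorm W N (L1.mk g hg) = ∫ x, ‖g x‖ * W.w N x := by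
  change ∫ x, ‖AEEqFun.mk g hg.1 x‖ * W.w N x = _
  refine integral_congr_ae ?_
  filter_upwards [AEEqFun.coeFn_mk g hg.1] with x hx
  rw [hx]

theorem Convolutor.seminorm_convL1 {W : IncreasingWeightSystem d} (f : Convolutor W) (N : ℕ)
    (φ : Test d) :
    L1.seminorm W N (f.convL1 φ) = ∫ x, ‖conv f.toDistr φ x‖ * W.w N x :=
  L1.seminorm_mk W N _ (f.2 φ)

/-- The value `(f ∗ φ)(0)` is controlled by finitely many weighted `L^1`-norms of convolutions
`f ∗ P φ` with differential operators `P` that do not depend on `f` and `φ`. -/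
theorem exists_norm_conv_zero_le (W : IncreasingWeightSystem d) :
    ∃ (C : ℝ) (ι : Type) (_ : Fintype ι) (P : ι → (Test d →L[ℂ] Test d)), 0 ≤ C ∧
      ∀ (f : Convolutor W) (φ : Test d),
        ‖conv f.toDistr φ 0‖ ≤ C * ∑ j, L1.seminorm W 0 (f.convL1 (P j φ)) := by
  obtain ⟨ι, hι, P, hP⟩ := exists_enorm_conv_le_lmarginal (d := d) Finset.univ
  set Q : Set (Fin d → ℝ) := univ.pi fun _ => Icc (0 : ℝ) 1
  have hQ : IsCompact Q := isCompact_univ_pi fun _ => isCompact_Icc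
  have hQ0 : (0 : Fin d → ℝ) ∈ Q := fun i _ => by simp
  -- the minimum `c` of `w_0` on the cube compares the unweighted integral with the norm
  obtain ⟨x₀, -, hx₀⟩ := hQ.exists_isMinOn (f := fun y => W.w 0 (ofCoords y)) ⟨0, hQ0⟩
    ((W.continuous_w 0).comp (PiLp.continuous_toLp 2 (fun _ : Fin d => ℝ))).continuousOn
  set c := W.w 0 (ofCoords x₀)
  have hc : 0 < c := W.pos _ _
  refine ⟨c⁻¹, ι, hι, P, by positivity, fun f φ => ?_⟩
  have hbound : ∀ ψ : Test d, ∫⁻ y in Q, ‖conv f.toDistr ψ (ofCoords y)‖ₑ ≤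
      ENNReal.ofReal (c⁻¹ * L1.seminorm W 0 (f.convL1 ψ)) := fun ψ => by
    have hint : Integrable (fun x => c⁻¹ * (‖conv f.toDistr ψ x‖ * W.w 0 x)) :=
      ((f.2 ψ).2 0).const_mul _
    have hnn : ∀ x, 0 ≤ c⁻¹ * (‖conv f.toDistr ψ x‖ * W.w 0 x) := fun x =>
      mul_nonneg (by positivity) (mul_nonneg (norm_nonneg _) (W.pos 0 x).le)
    rw [Convolutor.seminorm_convL1, ← integral_const_mul,
      ofReal_integral_eq_lintegral_ofReal hint (ae_of_all _ hnn),
      ← (PiLp.volume_preserving_toLp (Fin d)).lintegral_comp_emb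
        (MeasurableEquiv.toLp 2 (Fin d → ℝ)).measurableEmbedding]
    refine (setLIntegral_mono' hQ.measurableSet fun y hy => ?_).trans
      (setLIntegral_le_lintegral Q _)
    rw [← ofReal_norm]
    refine ENNReal.ofReal_le_ofReal ?_
    rw [inv_mul_eq_div, le_div_iff₀ hc]
    exact mul_le_mul_of_nonneg_left (hx₀ hy) (norm_nonneg _)
  have h := hP f.toDistr φ 0 fun i => by simp
  simp_rw [lmarginal_univ, ← Measure.restrict_pi_pi, ← volume_pi] at h
  have h2 := h.trans (Finset.sum_le_sum fun j _ => hbound (P j φ))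
  have hnn : ∀ j, 0 ≤ c⁻¹ * L1.seminorm W 0 (f.convL1 (P j φ)) := fun j => by positivity
  rw [← ENNReal.ofReal_sum_of_nonneg fun j _ => hnn j, ← ofReal_norm,
    ENNReal.ofReal_le_ofReal_iff (Finset.sum_nonneg fun j _ => hnn j), ← Finset.mul_sum] at h2
  exact h2

/-! ### Cauchy filters and convergence in the convolutor space -/

section Convergence

variable {W : IncreasingWeightSystem d} {𝓕 : Filter (Convolutor W)}

theorem Convolutor.convL1_sub (f g : Convolutor W) (φ : Test d) :
    (f - g).convL1 φ = f.convL1 φ - g.convL1 φ := by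
  have h := map_sub (Convolutor.toUniformOnBounded W) f g
  exact congrFun h φ

theorem L1.setOf_seminorm_sub_lt_mem_uniformity (N : ℕ) {ε : ℝ} (hε : 0 < ε) :
    {p : L1 W × L1 W | L1.seminorm W N (p.1 - p.2) < ε} ∈ uniformity (L1 W) := by
  rw [uniformity_eq_comap_nhds_zero_swapped]
  refine ⟨{x | L1.seminorm W N x < ε}, ?_, fun p hp => hp⟩
  have hc := (L1.withSeminorms W).continuous_seminorm N
  exact hc.continuousAt.eventually_lt continuousAt_const (by simpa using hε)

theorem Convolutor.exists_seminorm_sub_le_of_cauchy (h𝓕 : Cauchy 𝓕) {B : Set (Test d)}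
    (hB : Bornology.IsVonNBounded ℂ B) (N : ℕ) {ε : ℝ} (hε : 0 < ε) :
    ∃ S ∈ 𝓕, ∀ f ∈ S, ∀ g ∈ S, ∀ φ ∈ B, L1.seminorm W N ((f - g).convL1 φ) ≤ ε := by
  have hU := UniformOnFun.gen_mem_uniformity (L1 W) {B : Set (Test d) | Bornology.IsVonNBounded ℂ B}
    hB (L1.setOf_seminorm_sub_lt_mem_uniformity (W := W) N hε)
  have hV : (fun p : Convolutor W × Convolutor W =>
      (Convolutor.toUniformOnBounded W p.1, Convolutor.toUniformOnBounded W p.2)) ⁻¹'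
        UniformOnFun.gen {B : Set (Test d) | Bornology.IsVonNBounded ℂ B} B
          {p : L1 W × L1 W | L1.seminorm W N (p.1 - p.2) < ε} ∈ uniformity (Convolutor W) :=
    preimage_mem_comap hU
  obtain ⟨S, hS, hSV⟩ := (cauchy_iff.1 h𝓕).2 _ hV
  refine ⟨S, hS, fun f hf g hg φ hφ => ?_⟩
  have h : L1.seminorm W N (f.convL1 φ - g.convL1 φ) < ε := hSV (mk_mem_prod hf hg) φ hφ
  rw [convL1_sub]
  exact h.le

/-- The seminorms `f ↦ sup_{φ ∈ B} ‖f ∗ φ‖_{L^1_{w_N}}`, for `B` bounded, determine convergence. -/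
theorem Convolutor.le_nhds_of_forall_seminorm_sub_le {ℓ : Convolutor W}
    (h : ∀ B : Set (Test d), Bornology.IsVonNBounded ℂ B → ∀ (N : ℕ) (ε : ℝ), 0 < ε →
      ∃ S ∈ 𝓕, ∀ f ∈ S, ∀ φ ∈ B, L1.seminorm W N ((f - ℓ).convL1 φ) ≤ ε) : 𝓕 ≤ 𝓝 ℓ := by
  have hind : IsUniformInducing (Convolutor.toUniformOnBounded W) := ⟨rfl⟩
  have hgoal : Tendsto (fun f => Convolutor.toUniformOnBounded W f) 𝓕
      (𝓝 (Convolutor.toUniformOnBounded W ℓ)) := by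
    rw [UniformOnFun.tendsto_iff_tendstoUniformlyOn]
    intro B hB u hu
    rw [uniformity_eq_comap_nhds_zero_swapped] at hu
    obtain ⟨v, hv, hvu⟩ := hu
    obtain ⟨s, ε, hε, hball⟩ := (L1.withSeminorms W).mem_nhds_iff 0 v |>.1 hv
    have hfin : ∀ᶠ f in 𝓕, ∀ N ∈ s, ∀ φ ∈ B, L1.seminorm W N ((f - ℓ).convL1 φ) ≤ ε / 2 := by
      rw [eventually_all_finset]
      intro N _
      obtain ⟨S, hS, hSε⟩ := h B hB N (ε / 2) (by positivity)
      filter_upwards [hS] with f hf using hSε f hf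
    filter_upwards [hfin] with f hf φ hφ
    refine hvu (hball ?_)
    rw [Seminorm.mem_ball, sub_zero]
    refine Seminorm.finset_sup_apply_lt hε fun N hN => ?_
    change L1.seminorm W N (ℓ.convL1 φ - f.convL1 φ) < ε
    rw [map_sub_rev, ← convL1_sub]
    exact (hf N hN φ hφ).trans_lt (half_lt_self hε)
  exact (hind.isInducing.tendsto_nhds_iff (f := id)).2 hgoal

/-! ### The limit distribution -/

theorem conv_reflectTranslate_zero (f : Distr d) (φ : Test d) :
    conv f (reflectTranslate φ 0) 0 = f φ := by
  rw [conv, reflectTranslate_reflectTranslate]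

/-- A Cauchy filter of convolutors is Cauchy for the uniform convergence of distributions on
families of test functions with common support and bounds. -/
theorem Convolutor.exists_norm_toDistr_sub_le_of_cauchy (h𝓕 : Cauchy 𝓕) (K : Compacts (Rd d))
    (C : ℕ → ℝ) {ε : ℝ} (hε : 0 < ε) :
    ∃ S ∈ 𝓕, ∀ f ∈ S, ∀ g ∈ S, ∀ φ ∈ boundedFamily K C, ‖f.toDistr φ - g.toDistr φ‖ ≤ ε := by
  obtain ⟨A, ι, _, P, hA, hP⟩ := exists_norm_conv_zero_le W
  obtain ⟨K', hK'⟩ := exists_reflectTranslate_mem_boundedFamily K 0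
  -- the summand `1` keeps the denominator positive when `A` or the number of operators vanishes
  set δ := ε / (A * Fintype.card ι + 1) with hδ
  have hden : 0 < A * Fintype.card ι + 1 := by positivity
  have hS : ∀ j, ∃ S ∈ 𝓕, ∀ f ∈ S, ∀ g ∈ S, ∀ φ ∈ P j '' boundedFamily K' C,
      L1.seminorm W 0 ((f - g).convL1 φ) ≤ δ := fun j =>
    exists_seminorm_sub_le_of_cauchy h𝓕 ((isVonNBounded_boundedFamily K' C).image (P j)) 0
      (by positivity)
  choose S hS𝓕 hSδ using hS
  refine ⟨⋂ j, S j, iInter_mem.2 hS𝓕, fun f hf g hg φ hφ => ?_⟩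
  have h1 : f.toDistr φ - g.toDistr φ = conv (f - g).toDistr (reflectTranslate φ 0) 0 := by
    rw [conv_reflectTranslate_zero]; rfl
  rw [h1]
  calc ‖conv (f - g).toDistr (reflectTranslate φ 0) 0‖
      ≤ A * ∑ j, L1.seminorm W 0 ((f - g).convL1 (P j (reflectTranslate φ 0))) := hP _ _
    _ ≤ A * ∑ _j : ι, δ := by
      refine mul_le_mul_of_nonneg_left (Finset.sum_le_sum fun j _ => ?_) hA
      exact hSδ j f (mem_iInter.1 hf j) g (mem_iInter.1 hg j) _
        ⟨_, hK' C φ hφ 0 (by simp), rfl⟩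
    _ = A * Fintype.card ι * δ := by simp [mul_assoc]
    _ ≤ (A * Fintype.card ι + 1) * δ := by gcongr; linarith
    _ = ε := by rw [hδ]; field_simp

/-- A Cauchy filter of convolutors converges to a distribution, uniformly on families of test
functions with common support and bounds. The limit functional is continuous since `𝓓_K` is first
countable and null sequences in `𝓓_K` form such families. -/
theorem Convolutor.exists_distr_of_cauchy (h𝓕 : Cauchy 𝓕) :
    ∃ ℓ : Distr d, ∀ (K : Compacts (Rd d)) (C : ℕ → ℝ) (ε : ℝ), 0 < ε →
      ∃ S ∈ 𝓕, ∀ f ∈ S, ∀ φ ∈ boundedFamily K C, ‖f.toDistr φ - ℓ φ‖ ≤ ε := by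
  have := h𝓕.1
  have hlim : ∀ φ : Test d, ∃ z, Tendsto (fun f : Convolutor W => f.toDistr φ) 𝓕 (𝓝 z) := by
    intro φ
    refine CompleteSpace.complete (f := 𝓕.map fun f : Convolutor W => f.toDistr φ) ?_
    obtain ⟨K, C, hφ⟩ := exists_mem_boundedFamily φ
    refine Metric.cauchy_iff.2 ⟨inferInstance, fun ε hε => ?_⟩
    obtain ⟨S, hS, hSε⟩ := exists_norm_toDistr_sub_le_of_cauchy h𝓕 K C (half_pos hε)
    refine ⟨_, image_mem_map hS, ?_⟩
    rintro _ ⟨f, hf, rfl⟩ _ ⟨g, hg, rfl⟩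
    rw [dist_eq_norm]
    exact (hSε f hf g hg φ hφ).trans_lt (half_lt_self hε)
  choose L hL using hlim
  have hunif : ∀ (K : Compacts (Rd d)) (C : ℕ → ℝ) (ε : ℝ), 0 < ε →
      ∃ S ∈ 𝓕, ∀ f ∈ S, ∀ φ ∈ boundedFamily K C, ‖f.toDistr φ - L φ‖ ≤ ε := by
    intro K C ε hε
    obtain ⟨S, hS, hSε⟩ := exists_norm_toDistr_sub_le_of_cauchy h𝓕 K C hε
    refine ⟨S, hS, fun f hf φ hφ => ?_⟩
    refine le_of_tendsto ((tendsto_const_nhds.sub (hL φ)).norm) ?_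
    filter_upwards [hS] with g hg using hSε f hf g hg φ hφ
  have hadd : ∀ φ ψ, L (φ + ψ) = L φ + L ψ := fun φ ψ =>
    tendsto_nhds_unique (hL (φ + ψ)) (((hL φ).add (hL ψ)).congr fun f => by simp)
  have hsmul : ∀ (c : ℂ) φ, L (c • φ) = c • L φ := fun c φ =>
    tendsto_nhds_unique (hL (c • φ)) (((hL φ).const_smul c).congr fun f => by simp)
  refine ⟨TestFunction.mkCLM ℂ L hadd hsmul fun K hK => ?_, hunif⟩
  let T : 𝓓_{K}(Rd d, ℂ) →+ ℂ :=
    AddMonoidHom.mk' (L ∘ TestFunction.ofSupportedIn hK) fun φ ψ =>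
      hadd (TestFunction.ofSupportedIn hK φ) (TestFunction.ofSupportedIn hK ψ)
  change Continuous T
  have hsemi := ContDiffMapSupportedIn.withSeminorms ℂ (Rd d) ℂ ⊤ K
  have := hsemi.firstCountableTopology
  refine continuous_of_continuousAt_zero T ?_
  rw [ContinuousAt, map_zero]
  refine tendsto_of_seq_tendsto fun u hu => ?_
  have hbdd := hsemi.isVonNBounded_iff_seminorm_bounded.1 (hu.isVonNBounded_range ℂ)
  choose C _ hC using hbdd
  have hmem : ∀ n, TestFunction.ofSupportedIn hK (u n) ∈ boundedFamily K C := fun n =>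
    ⟨(u n).support_subset, fun k y =>
      (ContDiffMapSupportedIn.norm_iteratedFDeriv_apply_le_seminorm_top ℂ).trans
        (hC k (u n) (mem_range_self n)).le⟩
  rw [Metric.tendsto_atTop']
  intro ε hε
  obtain ⟨S, hS, hSε⟩ := hunif K C (ε / 2) (half_pos hε)
  obtain ⟨f, hf⟩ := Filter.nonempty_of_mem hS
  have hfu : Tendsto (fun n => f.toDistr (TestFunction.ofSupportedIn hK (u n))) atTop (𝓝 0) := by
    have h := ((f.toDistr.comp (TestFunction.ofSupportedInCLM ℂ hK)).continuous.tendsto 0).comp hu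
    rwa [map_zero] at h
  obtain ⟨n₀, hn₀⟩ := Metric.tendsto_atTop'.1 hfu (ε / 2) (half_pos hε)
  refine ⟨n₀, fun n hn => ?_⟩
  have h1 := hn₀ n hn
  have h2 := hSε f hf _ (hmem n)
  rw [dist_zero_right] at h1 ⊢
  change ‖L (TestFunction.ofSupportedIn hK (u n))‖ < ε
  have h3 := norm_sub_norm_le (L (TestFunction.ofSupportedIn hK (u n)))
    (f.toDistr (TestFunction.ofSupportedIn hK (u n)))
  rw [norm_sub_rev] at h3
  linarith

/-! ### The limit is a convolutor -/

theorem conv_sub (f g : Distr d) (φ : Test d) (x : Rd d) :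
    conv (f - g) φ x = conv f φ x - conv g φ x := rfl

theorem measurable_ofReal_norm_conv_mul (W : IncreasingWeightSystem d) (f : Distr d) (φ : Test d)
    (N : ℕ) : Measurable fun x => ENNReal.ofReal (‖conv f φ x‖ * W.w N x) :=
  ((continuous_conv f φ).norm.mul (W.continuous_w N)).measurable.ennreal_ofReal

theorem Convolutor.lintegral_conv_mul (f : Convolutor W) (φ : Test d) (N : ℕ) :
    ∫⁻ x, ENNReal.ofReal (‖conv f.toDistr φ x‖ * W.w N x) =
      ENNReal.ofReal (L1.seminorm W N (f.convL1 φ)) := by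
  have hint : Integrable (fun x => ‖conv f.toDistr φ x‖ * W.w N x) := (f.2 φ).2 N
  rw [seminorm_convL1, ofReal_integral_eq_lintegral_ofReal hint
    (ae_of_all _ fun x => mul_nonneg (norm_nonneg _) (W.pos N x).le)]

/-- Weighted `L^1`-bounds pass to the limit distribution, by Fatou's lemma along a sequence of
convolutors whose convolutions with `φ` converge locally uniformly. -/
theorem Convolutor.lintegral_conv_sub_mul_le [𝓕.NeBot] {ℓ : Distr d}
    (hℓ : ∀ (K : Compacts (Rd d)) (C : ℕ → ℝ) (ε : ℝ), 0 < ε →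
      ∃ S ∈ 𝓕, ∀ f ∈ S, ∀ φ ∈ boundedFamily K C, ‖f.toDistr φ - ℓ φ‖ ≤ ε)
    {S : Set (Convolutor W)} (hS : S ∈ 𝓕) {f : Convolutor W} {φ : Test d} {N : ℕ} {ε : ℝ}
    (hf : ∀ g ∈ S, L1.seminorm W N ((f - g).convL1 φ) ≤ ε) :
    ∫⁻ x, ENNReal.ofReal (‖conv (f.toDistr - ℓ) φ x‖ * W.w N x) ≤ ENNReal.ofReal ε := by
  obtain ⟨K, C, hφ⟩ := exists_mem_boundedFamily φ
  have hg : ∀ n : ℕ, ∃ g ∈ S, ∀ x : Rd d, ‖x‖ ≤ n →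
      ‖conv g.toDistr φ x - conv ℓ φ x‖ ≤ 1 / ((n : ℝ) + 1) := fun n => by
    obtain ⟨K', hK'⟩ := exists_reflectTranslate_mem_boundedFamily K n
    obtain ⟨S', hS', hSn⟩ := hℓ K' C (1 / ((n : ℝ) + 1)) (by positivity)
    obtain ⟨g, hgS, hgS'⟩ := Filter.nonempty_of_mem (inter_mem hS hS')
    exact ⟨g, hgS, fun x hx => hSn g hgS' _ (hK' C φ hφ x hx)⟩
  choose g hgS hgn using hg
  have hpt : ∀ x, Tendsto (fun n => conv (g n).toDistr φ x) atTop (𝓝 (conv ℓ φ x)) := fun x => by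
    rw [tendsto_iff_norm_sub_tendsto_zero]
    refine squeeze_zero' (Eventually.of_forall fun n => norm_nonneg _) ?_
      tendsto_one_div_add_atTop_nhds_zero_nat
    filter_upwards [eventually_ge_atTop ⌈‖x‖⌉₊] with n hn
    exact hgn n x (Nat.ceil_le.1 hn)
  have hlim : ∀ x, ENNReal.ofReal (‖conv (f.toDistr - ℓ) φ x‖ * W.w N x) =
      liminf (fun n => ENNReal.ofReal (‖conv (f - g n).toDistr φ x‖ * W.w N x)) atTop := fun x => by
    refine (Tendsto.liminf_eq ?_).symm
    refine ENNReal.tendsto_ofReal (Tendsto.mul_const _ (Tendsto.norm ?_))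
    exact tendsto_const_nhds.sub (hpt x)
  simp_rw [hlim]
  refine (lintegral_liminf_le fun n => measurable_ofReal_norm_conv_mul W _ φ N).trans ?_
  refine (liminf_le_liminf (v := fun _ => ENNReal.ofReal ε)
    (Eventually.of_forall fun n => ?_)).trans (liminf_const _).le
  rw [lintegral_conv_mul]
  exact ENNReal.ofReal_le_ofReal (hf _ (hgS n))

/-- `ℓ ∗ φ` belongs to `L^1_W` if, for each weight, it is at finite distance from some `f ∗ φ` with
`f` a convolutor, which may depend on the weight. -/
theorem memL1_conv_of_lintegral_sub_ne_top {ℓ : Distr d} {φ : Test d}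
    (h : ∀ N, ∃ f : Convolutor W,
      ∫⁻ x, ENNReal.ofReal (‖conv (f.toDistr - ℓ) φ x‖ * W.w N x) ≠ ⊤) :
    W.MemL1 (conv ℓ φ) := by
  refine ⟨(continuous_conv ℓ φ).aestronglyMeasurable, fun N => ?_⟩
  obtain ⟨f, hf⟩ := h N
  have hcont : ∀ g : Distr d, AEStronglyMeasurable (fun x => ‖conv g φ x‖ * W.w N x) volume :=
    fun g => ((continuous_conv g φ).norm.mul (W.continuous_w N)).aestronglyMeasurable
  have hnn : ∀ (g : Distr d) (x : Rd d), 0 ≤ ‖conv g φ x‖ * W.w N x := fun g x =>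
    mul_nonneg (norm_nonneg _) (W.pos N x).le
  have hdiff : Integrable (fun x => ‖conv (f.toDistr - ℓ) φ x‖ * W.w N x) volume :=
    (lintegral_ofReal_ne_top_iff_integrable (hcont _) (ae_of_all _ (hnn _))).1 hf
  refine (((f.2 φ).2 N).add hdiff).mono' (hcont ℓ) (ae_of_all _ fun x => ?_)
  rw [Real.norm_of_nonneg (hnn ℓ x)]
  change _ ≤ ‖conv f.toDistr φ x‖ * W.w N x + ‖conv (f.toDistr - ℓ) φ x‖ * W.w N x
  rw [← add_mul, conv_sub]
  refine mul_le_mul_of_nonneg_right ?_ (W.pos N x).le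
  simpa using norm_sub_le (conv f.toDistr φ x) (conv f.toDistr φ x - conv ℓ φ x)

end Convergence

end WeightedConvolutors

end

theorem mainTheorem12 (d : ℕ) (W : WeightedConvolutors.IncreasingWeightSystem d)
    (hW : W.IsLocallyBounded) :
    CompleteSpace (WeightedConvolutors.Convolutor W) := by
  open WeightedConvolutors in
  refine ⟨fun {𝓕} h𝓕 => ?_⟩
  have := h𝓕.1
  obtain ⟨ℓ, hℓ⟩ := Convolutor.exists_distr_of_cauchy h𝓕
  have hmem : ∀ φ : Test d, W.MemL1 (conv ℓ φ) := fun φ =>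
    memL1_conv_of_lintegral_sub_ne_top fun N => by
      obtain ⟨K, C, hφ⟩ := exists_mem_boundedFamily φ
      obtain ⟨S, hS, hSε⟩ := Convolutor.exists_seminorm_sub_le_of_cauchy h𝓕
        (isVonNBounded_boundedFamily K C) N one_pos
      obtain ⟨f, hf⟩ := Filter.nonempty_of_mem hS
      exact ⟨f, ((Convolutor.lintegral_conv_sub_mul_le hℓ hS
        fun g hg => hSε f hf g hg φ hφ).trans_lt ENNReal.ofReal_lt_top).ne⟩
  refine ⟨⟨ℓ, hmem⟩, Convolutor.le_nhds_of_forall_seminorm_sub_le fun B hB N ε hε => ?_⟩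
  obtain ⟨S, hS, hSε⟩ := Convolutor.exists_seminorm_sub_le_of_cauchy h𝓕 hB N hε
  refine ⟨S, hS, fun f hf φ hφ => ?_⟩
  rw [← ENNReal.ofReal_le_ofReal_iff hε.le, ← Convolutor.lintegral_conv_mul]
  exact Convolutor.lintegral_conv_sub_mul_le hℓ hS fun g hg => hSε f hf g hg φ hφ
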